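/- Let $\mathbb X\subset\mathbb R$ be the real line or a subinterval of it (finite or infinite). A lattice $\mathcal L$ on $\mathbb X$ is a collection $\mathcal L=\bigcup_{k\in\mathbb Z}\mathcal L_k$ of bounded intervals $[a,b)$, $a<b$, such that each generation $\mathcal L_k$ is a partition of $\mathbb X$, and each $I\in\mathcal L_k$ is a finite disjoint union of intervals of $\mathcal L_{k+1}$ (possibly of only one, so that an interval may belong to several generations; it is still counted once in $\mathcal L$). For sequences $s=\{s_I\}_{I\in\mathcal L}$ of scalars (real or complex) put, for $1\le p,q,r<\infty$, $$\|s\|_{\dot g_p^q}:=\Bigl\|\Bigl(\sum_{I\in\mathcal L}|s_I|^q\mathbf 1_I\Bigr)^{1/q}\Bigr\|_{L^p(\mathbb X)},\qquad \|s\|_{\dot g_\infty^{q,(r)}}:=\sup_{J\in\mathcal L}\Bigl(\frac1{|J|}\int_J\Bigl(\sum_{I\in\mathcal L,\,I\subset J}|s_I|^q\mathbf 1_I\Bigr)^{r/q}dx\Bigr)^{1/r},$$ let $\dot g_p^q=\dot g_p^q(\mathcal L)$ and $\dot g_\infty^{q,(r)}=\dot g_\infty^{q,(r)}(\mathcal L)$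 be the normed spaces of the sequences for which these quantities are finite, and let $\dot g_\infty^{q}:=\dot g_\infty^{q,(q)}$. **Theorem.** Let $1<q<\infty$ and $1/q+1/q'=1$. 1. The spaces $\dot g_\infty^{q,(r)}(\mathcal L)$, $1\le r<\infty$, do not depend on $r$ and their norms are equivalent: for all $r_1,r_2\in[1,\infty)$ there is a constant $C$, depending only on $q,r_1,r_2$ and not on the lattice $\mathcal L$, such that $\dot g_\infty^{q,(r_1)}(\mathcal L)=\dot g_\infty^{q,(r_2)}(\mathcal L)$ and $C^{-1}\|s\|_{\dot g_\infty^{q,(r_2)}}\le\|s\|_{\dot g_\infty^{q,(r_1)}}\le C\|s\|_{\dot g_\infty^{q,(r_2)}}$ for every sequence $s$. 2. The dual space $(\dot g_1^q(\mathcal L))^*$ is isomorphic to $\dot g_\infty^{q'}(\mathcal L)$ under the pairing $$\langle f,g\rangle=\int_{\mathbb X}\sum_{I\in\mathcal L}f_Ig_I\mathbf 1_I\,dx=\sum_{I\in\mathcal L}f_Ig_I|I| .$$ That is, for $f\in\dot g_1^q$ and $g\in\dot g_\infty^{q'}$ the last series converges unconditionally, and $g\mapsto\langle\,\cdot\,,g\rangle$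 is a linear homeomorphism $\Phi$ of $\dot g_\infty^{q'}(\mathcal L)$ onto $(\dot g_1^q(\mathcal L))^*$ with $C^{-1}\|g\|\le\|\Phi g\|\le C\|g\|$, where $C$ depends only on $q$ and not on $\mathcal L$. -/

import Mathlib

open MeasureTheory Set
open scoped ENNReal NNReal

noncomputable section

/-- A lattice of intervals on `carrier`, an interval of `ℝ` (bounded or not, possibly all of `ℝ`):
generations indexed by `ℤ`, each a partition of the carrier into bounded intervals `[a, b)`,
`a < b`, the next generation splitting every interval into finitely many pieces (possibly only
one, so that an interval may belong to several generations). -/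
structure IntervalLattice where
  carrier : Set ℝ
  ordConnected : carrier.OrdConnected
  gen : ℤ → Set (Set ℝ)
  isInterval : ∀ k, ∀ I ∈ gen k, ∃ a b : ℝ, a < b ∧ I = Ico a b
  pairwiseDisjoint : ∀ k, (gen k).PairwiseDisjoint id
  sUnion_eq : ∀ k, ⋃₀ gen k = carrier
  refine_finite : ∀ k, ∀ I ∈ gen k, ∃ F : Set (Set ℝ), F.Finite ∧ F ⊆ gen (k + 1) ∧ ⋃₀ F = I

namespace IntervalLattice

variable (L : IntervalLattice)

/-- The intervals of the lattice. An interval lying in several generations is counted once. -/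
def intervals : Set (Set ℝ) := ⋃ k, L.gen k

/-- The index type of the sequences `{s_I}`. -/
abbrev Ix : Type := L.intervals

theorem exists_eq_Ico (I : L.Ix) : ∃ a b : ℝ, a < b ∧ (I : Set ℝ) = Ico a b := by
  obtain ⟨k, hk⟩ := mem_iUnion.1 I.2
  exact L.isInterval k _ hk

theorem measurableSet_ix (I : L.Ix) : MeasurableSet (I : Set ℝ) := by
  obtain ⟨a, b, -, h⟩ := L.exists_eq_Ico I
  rw [h]; exact measurableSet_Ico

theorem volume_ix_ne_zero (I : L.Ix) : volume (I : Set ℝ) ≠ 0 := by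
  obtain ⟨a, b, hab, h⟩ := L.exists_eq_Ico I
  rw [h, Real.volume_Ico]; simpa using hab

theorem volume_ix_ne_top (I : L.Ix) : volume (I : Set ℝ) ≠ ∞ := by
  obtain ⟨a, b, hab, h⟩ := L.exists_eq_Ico I
  rw [h, Real.volume_Ico]; exact ENNReal.ofReal_ne_top

theorem ix_subset_carrier (I : L.Ix) : (I : Set ℝ) ⊆ L.carrier := by
  obtain ⟨k, hk⟩ := mem_iUnion.1 I.2
  rw [← L.sUnion_eq k]; exact subset_sUnion_of_mem hk

theorem countable_intervals : L.intervals.Countable := by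
  refine countable_iUnion fun k => ?_
  refine (L.pairwiseDisjoint k).countable_of_nonempty_interior fun I hI => ?_
  obtain ⟨a, b, hab, rfl⟩ := L.isInterval k I hI
  simpa [interior_Ico] using hab

instance : Countable L.Ix := L.countable_intervals.to_subtype

end IntervalLattice

/-- An extended norm on the sequences `ι → 𝕜`. -/
structure SeqENorm (𝕜 : Type*) [RCLike 𝕜] (ι : Type*) where
  toFun : (ι → 𝕜) → ℝ≥0∞
  map_smul' : ∀ (c : 𝕜) s, toFun (c • s) = ‖c‖ₑ * toFun s
  add_le' : ∀ s t, toFun (s + t) ≤ toFun s + toFun t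
  eq_zero' : ∀ s, toFun s = 0 → s = 0

namespace SeqENorm

variable {𝕜 : Type*} [RCLike 𝕜] {ι : Type*} (N : SeqENorm 𝕜 ι)

theorem map_zero' : N.toFun 0 = 0 := by
  simpa using N.map_smul' 0 0

/-- The set of sequences of finite norm. -/
def finite : Submodule 𝕜 (ι → 𝕜) where
  carrier := {s | N.toFun s < ∞}
  zero_mem' := by simp [N.map_zero']
  add_mem' := fun {s t} hs ht =>
    lt_of_le_of_lt (N.add_le' s t) (ENNReal.add_lt_top.2 ⟨hs, ht⟩)
  smul_mem' := fun c s hs => by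
    have : N.toFun (c • s) < ∞ := by
      rw [N.map_smul']; exact ENNReal.mul_lt_top enorm_lt_top hs
    exact this

/-- The sequences of finite norm as a normed space, with that norm. (It is a type of its own, so
that its topology is the one of the norm, not the one of coordinatewise convergence.) -/
def Space : Type _ := N.finite

instance : AddCommGroup N.Space := inferInstanceAs (AddCommGroup N.finite)
instance : Module 𝕜 N.Space := inferInstanceAs (Module 𝕜 N.finite)
instance : CoeFun N.Space fun _ => ι → 𝕜 := ⟨fun f => f.1⟩
instance : Norm N.Space := ⟨fun f => (N.toFun f).toReal⟩

theorem normCore : NormedSpace.Core 𝕜 N.Space where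
  norm_nonneg _ := ENNReal.toReal_nonneg
  norm_smul c f := by
    change (N.toFun (c • f.1)).toReal = ‖c‖ * (N.toFun f.1).toReal
    rw [N.map_smul', ENNReal.toReal_mul, toReal_enorm]
  norm_triangle f g := by
    change (N.toFun (f.1 + g.1)).toReal ≤ (N.toFun f.1).toReal + (N.toFun g.1).toReal
    rw [← ENNReal.toReal_add f.2.ne g.2.ne]
    exact ENNReal.toReal_mono (ENNReal.add_ne_top.2 ⟨f.2.ne, g.2.ne⟩) (N.add_le' _ _)
  norm_eq_zero_iff f := by
    change (N.toFun f.1).toReal = 0 ↔ f = 0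
    rw [ENNReal.toReal_eq_zero_iff, or_iff_left f.2.ne]
    refine ⟨fun h => Subtype.ext (N.eq_zero' _ h), ?_⟩
    rintro rfl
    exact N.map_zero'

instance : NormedAddCommGroup N.Space := NormedAddCommGroup.ofCore N.normCore
instance : NormedSpace 𝕜 N.Space := NormedSpace.ofCore N.normCore

end SeqENorm

namespace IntervalLattice

variable (L : IntervalLattice) {𝕜 : Type*} [RCLike 𝕜]

/-- `x ↦ (∑_{I ∈ E} |s_I| ^ q 1_I(x)) ^ (1 / q)`. -/
def sqFun (q : ℝ) (E : Set L.Ix) (s : L.Ix → 𝕜) (x : ℝ) : ℝ≥0∞ :=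
  (∑' I : E, (I : Set ℝ).indicator (fun _ => ‖s I‖ₑ ^ q) x) ^ (1 / q)

theorem measurable_sqFun (q : ℝ) (E : Set L.Ix) (s : L.Ix → 𝕜) : Measurable (L.sqFun q E s) := by
  refine Measurable.pow_const (Measurable.tsum fun I => ?_) _
  exact measurable_const.indicator (L.measurableSet_ix I)

theorem sqFun_smul {q : ℝ} (hq : 1 ≤ q) (E : Set L.Ix) (c : 𝕜) (s : L.Ix → 𝕜) (x : ℝ) :
    L.sqFun q E (c • s) x = ‖c‖ₑ * L.sqFun q E s x := by
  have h0 : 0 ≤ q := by linarith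
  have hq0 : q ≠ 0 := by linarith
  unfold sqFun
  have : ∀ I : E, (I : Set ℝ).indicator (fun _ => ‖(c • s) I‖ₑ ^ q) x
      = ‖c‖ₑ ^ q * (I : Set ℝ).indicator (fun _ => ‖s I‖ₑ ^ q) x := fun I => by
    by_cases hx : x ∈ (I : Set ℝ)
    · simp [hx, ENNReal.mul_rpow_of_nonneg _ _ h0]
    · simp [hx]
  simp_rw [this]
  rw [ENNReal.tsum_mul_left, ENNReal.mul_rpow_of_nonneg _ _ (by positivity), ← ENNReal.rpow_mul,
    mul_one_div_cancel hq0, ENNReal.rpow_one]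

theorem sqFun_add_le {q : ℝ} (hq : 1 ≤ q) (E : Set L.Ix) (s t : L.Ix → 𝕜) (x : ℝ) :
    L.sqFun q E (s + t) x ≤ L.sqFun q E s x + L.sqFun q E t x := by
  have h0 : 0 < q := by linarith
  have key : ∀ u : L.Ix → 𝕜, ∀ I : E, (I : Set ℝ).indicator (fun _ => ‖u I‖ₑ ^ q) x
      = ((I : Set ℝ).indicator (fun _ => ‖u I‖ₑ) x) ^ q := fun u I => by
    by_cases hx : x ∈ (I : Set ℝ)
    · simp [hx]
    · simp [hx, h0]
  unfold sqFun
  simp_rw [key]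
  let _ : MeasurableSpace E := ⊤
  rw [← lintegral_count, ← lintegral_count, ← lintegral_count]
  refine le_trans (ENNReal.rpow_le_rpow (lintegral_mono fun I => ?_) (by positivity))
    (ENNReal.lintegral_Lp_add_le (measurable_from_top.aemeasurable)
      (measurable_from_top.aemeasurable) hq)
  refine ENNReal.rpow_le_rpow ?_ h0.le
  by_cases hx : x ∈ (I : Set ℝ)
  · simpa [hx] using enorm_add_le _ _
  · simp [hx]

theorem le_sqFun {q : ℝ} (hq : 1 ≤ q) {E : Set L.Ix} (s : L.Ix → 𝕜) {I : L.Ix} (hI : I ∈ E)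
    {x : ℝ} (hx : x ∈ (I : Set ℝ)) : ‖s I‖ₑ ≤ L.sqFun q E s x := by
  have hq0 : q ≠ 0 := by linarith
  have h : ‖s I‖ₑ ^ q ≤ ∑' I : E, (I : Set ℝ).indicator (fun _ => ‖s I‖ₑ ^ q) x := by
    refine le_trans ?_ (ENNReal.le_tsum (⟨I, hI⟩ : E))
    simp [hx]
  have h2 := ENNReal.rpow_le_rpow (z := 1 / q) h (by positivity)
  rwa [← ENNReal.rpow_mul, mul_one_div_cancel hq0, ENNReal.rpow_one] at h2

/-- The `L^p(μ)` norm of `sqFun`. -/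
def lpSqFun (μ : Measure ℝ) (p q : ℝ) (E : Set L.Ix) (s : L.Ix → 𝕜) : ℝ≥0∞ :=
  (∫⁻ x, L.sqFun q E s x ^ p ∂μ) ^ (1 / p)

theorem lpSqFun_smul (μ : Measure ℝ) {p q : ℝ} (hp : 1 ≤ p) (hq : 1 ≤ q) (E : Set L.Ix) (c : 𝕜)
    (s : L.Ix → 𝕜) : L.lpSqFun μ p q E (c • s) = ‖c‖ₑ * L.lpSqFun μ p q E s := by
  have h0 : 0 ≤ p := by linarith
  have hp0 : p ≠ 0 := by linarith
  unfold lpSqFun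
  simp_rw [L.sqFun_smul hq, ENNReal.mul_rpow_of_nonneg _ _ h0]
  rw [lintegral_const_mul _ ((L.measurable_sqFun q E s).pow_const p),
    ENNReal.mul_rpow_of_nonneg _ _ (by positivity), ← ENNReal.rpow_mul,
    mul_one_div_cancel hp0, ENNReal.rpow_one]

theorem lpSqFun_add_le (μ : Measure ℝ) {p q : ℝ} (hp : 1 ≤ p) (hq : 1 ≤ q) (E : Set L.Ix)
    (s t : L.Ix → 𝕜) :
    L.lpSqFun μ p q E (s + t) ≤ L.lpSqFun μ p q E s + L.lpSqFun μ p q E t := by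
  refine le_trans (ENNReal.rpow_le_rpow (lintegral_mono fun x => ?_) (by positivity))
    (ENNReal.lintegral_Lp_add_le (L.measurable_sqFun q E s).aemeasurable
      (L.measurable_sqFun q E t).aemeasurable hp)
  exact ENNReal.rpow_le_rpow (L.sqFun_add_le hq E s t x) (by linarith)

theorem eq_zero_of_lpSqFun {μ : Measure ℝ} {p q : ℝ} (hp : 1 ≤ p) (hq : 1 ≤ q) {E : Set L.Ix}
    {s : L.Ix → 𝕜} (h : L.lpSqFun μ p q E s = 0) {I : L.Ix} (hI : I ∈ E)
    (hμ : μ (I : Set ℝ) ≠ 0) : s I = 0 := by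
  have hp0 : 0 < p := by linarith
  have h1 : ∫⁻ x, L.sqFun q E s x ^ p ∂μ = 0 := by
    rcases ENNReal.rpow_eq_zero_iff.1 h with h | h
    · exact h.1
    · exact absurd h.2 (not_lt.2 (by positivity))
  by_contra hne
  have h2 : ‖s I‖ₑ ^ p * μ (I : Set ℝ) ≤ ∫⁻ x, L.sqFun q E s x ^ p ∂μ := by
    rw [← setLIntegral_const]
    refine le_trans (setLIntegral_mono ((L.measurable_sqFun q E s).pow_const p) fun x hx => ?_)
      (setLIntegral_le_lintegral _ _)
    exact ENNReal.rpow_le_rpow (L.le_sqFun hq s hI hx) hp0.le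
  rw [h1, nonpos_iff_eq_zero, mul_eq_zero, or_iff_left hμ, ENNReal.rpow_eq_zero_iff] at h2
  rcases h2 with h2 | h2
  · exact hne (by simpa using h2.1)
  · exact absurd h2.2 (not_lt.2 hp0.le)

variable (𝕜)

/-- The norm `‖(∑_I |s_I| ^ q 1_I) ^ (1 / q)‖_{L^p}`, `1 ≤ p, q < ∞`. -/
def gNorm (p q : ℝ) [hp : Fact (1 ≤ p)] [hq : Fact (1 ≤ q)] : SeqENorm 𝕜 L.Ix where
  toFun s := (∫⁻ x in L.carrier, L.sqFun q univ s x ^ p) ^ (1 / p)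
  map_smul' := L.lpSqFun_smul _ hp.out hq.out univ
  add_le' := L.lpSqFun_add_le _ hp.out hq.out univ
  eq_zero' s hs := by
    funext I
    refine L.eq_zero_of_lpSqFun hp.out hq.out hs (mem_univ I) ?_
    rw [Measure.restrict_apply (L.measurableSet_ix I),
      inter_eq_self_of_subset_left (L.ix_subset_carrier I)]
    exact L.volume_ix_ne_zero I

/-- The norm `sup_J (|J|⁻¹ ∫_J (∑_{I ⊆ J} |s_I| ^ q 1_I) ^ (r / q)) ^ (1 / r)`,
`1 ≤ q, r < ∞`; the average `|J|⁻¹ ∫_J` is written `⨍⁻ x in J`. -/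
def gInfNorm (q r : ℝ) [hq : Fact (1 ≤ q)] [hr : Fact (1 ≤ r)] : SeqENorm 𝕜 L.Ix where
  toFun s := ⨆ J : L.Ix,
    (⨍⁻ x in (J : Set ℝ), L.sqFun q {I | (I : Set ℝ) ⊆ J} s x ^ r ∂volume) ^ (1 / r)
  map_smul' c s := by
    rw [ENNReal.mul_iSup]
    exact iSup_congr fun J => L.lpSqFun_smul _ hr.out hq.out _ c s
  add_le' s t := iSup_le fun J =>
    (L.lpSqFun_add_le _ hr.out hq.out _ s t).trans
      (add_le_add (le_iSup (fun J : L.Ix => (⨍⁻ x in (J : Set ℝ),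
          L.sqFun q {I | (I : Set ℝ) ⊆ J} s x ^ r ∂volume) ^ (1 / r)) J)
        (le_iSup (fun J : L.Ix => (⨍⁻ x in (J : Set ℝ),
          L.sqFun q {I | (I : Set ℝ) ⊆ J} t x ^ r ∂volume) ^ (1 / r)) J))
  eq_zero' s hs := by
    funext J
    refine L.eq_zero_of_lpSqFun hr.out hq.out (ENNReal.iSup_eq_zero.1 hs J)
      (subset_refl (J : Set ℝ)) ?_
    rw [Measure.smul_apply, Measure.restrict_apply_self, Measure.restrict_apply_univ, smul_eq_mul,
      ENNReal.inv_mul_cancel (L.volume_ix_ne_zero J) (L.volume_ix_ne_top J)]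
    exact one_ne_zero

/-- The space of type `(p, q)`, `1 ≤ p, q < ∞`. -/
abbrev G (p q : ℝ) [Fact (1 ≤ p)] [Fact (1 ≤ q)] : Type _ := (L.gNorm 𝕜 p q).Space

/-- The space of type `(∞, q)`, `1 ≤ q < ∞`: its norm has `r = q`, that is, it is
`sup_J (|J|⁻¹ ∫_J ∑_{I ⊆ J} |s_I| ^ q 1_I) ^ (1 / q)`. -/
abbrev GInf (q : ℝ) [Fact (1 ≤ q)] : Type _ := (L.gInfNorm 𝕜 q q).Space

end IntervalLattice

instance factOneLeOne : Fact ((1 : ℝ) ≤ 1) := ⟨le_refl 1⟩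

end

noncomputable section

/-! ### Nestedness of the lattice and sums over nested intervals -/

namespace IntervalLattice

variable (L : IntervalLattice)

/-! Everything rests on nestedness: the lattice intervals through a point form a chain, so any
finite set of them has a largest member, and a sum over the set is at most the full sum below that
member.

For part 1, put `a I = ‖s I‖ₑ ^ q` and let `A_J` be the sum of `a I * 1_I` over `I ⊆ J`. Raising the
exponent is a John–Nirenberg argument: peeling off largest intervals gives `A_J ^ (n+1) ≤ (n+1) ∑ a
I * A_I ^ n * 1_I`, and integration with induction on `n` gives `∫_J A_J ^ n ≤ n! N ^ n |J|`
(`setLIntegral_pileSum_pow_le`). Lowering it to any `r ≥ 1` uses good parts: by Chebyshev, `A_I ≤ c`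
on at least half of each `I`. Replacing every `|I|` by twice its good part costs a factor 2, and the
sum of `a` over the good parts through one point is at most `c` (`tsum_indicator_goodPart_le`).

The same good parts, taken for `g`, give the duality bound: Hölder in the summation at each point
yields `∑ |f_I g_I| |I| ≤ 4 ‖g‖ ‖f‖` (`tsum_mul_volume_le`). Conversely, a functional `φ` has
coefficients `g_I = φ(e_I) / |I|` with `e_I` the unit sequences. Testing `φ` on the extremal finite
sequence below `J` gives `‖g‖ ≤ ‖φ‖` (`sum_rpow_mul_volume_le`), and density of finite sequences
shows that `g` represents `φ`. -/

theorem subset_or_disjoint_of_gen (k : ℤ) (n : ℕ) {I : Set ℝ} (hI : I ∈ L.gen k) :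
    ∀ {J : Set ℝ}, J ∈ L.gen (k + n) → J ⊆ I ∨ Disjoint J I := by
  induction n with
  | zero =>
    intro J hJ
    rw [Nat.cast_zero, add_zero] at hJ
    by_cases h : J = I
    · exact Or.inl h.le
    · exact Or.inr (L.pairwiseDisjoint k hJ hI h)
  | succ n ih =>
    intro J hJ
    obtain ⟨a, b, hab, hJab⟩ := L.isInterval _ J hJ
    -- One point of `J` locates its parent: the piece of `J'` through `a` and `J` lie in the same
    -- generation and meet, hence coincide.
    have ha : a ∈ J := by rw [hJab]; exact left_mem_Ico.2 hab
    have hc : a ∈ ⋃₀ L.gen (k + n) := by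
      rw [L.sUnion_eq, ← L.sUnion_eq (k + (n + 1 : ℕ))]; exact ⟨J, hJ, ha⟩
    obtain ⟨J', hJ', haJ'⟩ := hc
    obtain ⟨F, -, hF, hFJ'⟩ := L.refine_finite _ J' hJ'
    have haF := haJ'
    rw [← hFJ'] at haF
    obtain ⟨J₂, hJ₂, haJ₂⟩ := haF
    have hJ₂' : J₂ ∈ L.gen (k + (n + 1 : ℕ)) := by
      rw [Nat.cast_succ, ← add_assoc]; exact hF hJ₂
    have hJJ₂ : J = J₂ := by
      by_contra hne
      exact disjoint_left.1 (L.pairwiseDisjoint _ hJ hJ₂' hne) ha haJ₂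
    have hsub : J ⊆ J' := by
      rw [hJJ₂, ← hFJ']; exact subset_sUnion_of_mem hJ₂
    exact (ih hJ').imp hsub.trans fun h => h.mono_left hsub

theorem subset_or_subset {I J : L.Ix} {x : ℝ} (hI : x ∈ (I : Set ℝ)) (hJ : x ∈ (J : Set ℝ)) :
    (I : Set ℝ) ⊆ J ∨ (J : Set ℝ) ⊆ I := by
  obtain ⟨k, hk⟩ := mem_iUnion.1 I.2
  obtain ⟨m, hm⟩ := mem_iUnion.1 J.2
  rcases le_total k m with h | h
  · obtain ⟨n, rfl⟩ := Int.le.dest h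
    exact Or.inr ((L.subset_or_disjoint_of_gen k n hk hm).resolve_right
      fun hd => disjoint_left.1 hd hJ hI)
  · obtain ⟨n, rfl⟩ := Int.le.dest h
    exact Or.inl ((L.subset_or_disjoint_of_gen m n hm hk).resolve_right
      fun hd => disjoint_left.1 hd hI hJ)

theorem exists_largest {F : Finset L.Ix} (hF : F.Nonempty) {x : ℝ}
    (hx : ∀ I ∈ F, x ∈ (I : Set ℝ)) : ∃ I ∈ F, ∀ K ∈ F, (K : Set ℝ) ⊆ I := by
  obtain ⟨I, hI⟩ := F.exists_maximal hF
  refine ⟨I, hI.1, fun K hK => ?_⟩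
  rcases L.subset_or_subset (hx K hK) (hx I hI.1) with h | h
  · exact h
  · exact hI.2 hK h

/-- The intervals of the lattice contained in `J`. -/
def below (J : L.Ix) : Set L.Ix := {I | (I : Set ℝ) ⊆ J}

/-- `x ↦ ∑_{I ∈ E} a_I 1_I(x)`. -/
def pileSum (a : L.Ix → ℝ≥0∞) (E : Set L.Ix) (x : ℝ) : ℝ≥0∞ :=
  ∑' I : E, (I : Set ℝ).indicator (fun _ => a I) x

theorem pileSum_eq_tsum (a : L.Ix → ℝ≥0∞) (E : Set L.Ix) (x : ℝ) :
    L.pileSum a E x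
      = ∑' I : L.Ix, E.indicator (fun I => (I : Set ℝ).indicator (fun _ => a I) x) I :=
  tsum_subtype E fun I : L.Ix => (I : Set ℝ).indicator (fun _ => a I) x

theorem measurable_pileSum (a : L.Ix → ℝ≥0∞) (E : Set L.Ix) : Measurable (L.pileSum a E) :=
  Measurable.tsum fun I => measurable_const.indicator (L.measurableSet_ix I)

theorem sum_le_pileSum (a : L.Ix → ℝ≥0∞) {E : Set L.Ix} {x : ℝ} {F : Finset L.Ix}
    (hF : ∀ I ∈ F, I ∈ E ∧ x ∈ (I : Set ℝ)) : ∑ I ∈ F, a I ≤ L.pileSum a E x := by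
  rw [pileSum_eq_tsum]
  refine le_trans (Finset.sum_le_sum fun I hI => ?_) (ENNReal.sum_le_tsum F)
  simp [hF I hI]

theorem pileSum_le_of_forall_sum_le {a : L.Ix → ℝ≥0∞} {E : Set L.Ix} {x : ℝ} {c : ℝ≥0∞}
    (h : ∀ F : Finset L.Ix, (∀ I ∈ F, I ∈ E ∧ x ∈ (I : Set ℝ)) → ∑ I ∈ F, a I ≤ c) :
    L.pileSum a E x ≤ c := by
  classical
  rw [pileSum_eq_tsum, ENNReal.tsum_eq_iSup_sum]
  refine iSup_le fun F => ?_
  refine le_trans (le_of_eq ?_) (h (F.filter fun I => I ∈ E ∧ x ∈ (I : Set ℝ))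
    fun I hI => (Finset.mem_filter.1 hI).2)
  rw [Finset.sum_filter]
  refine Finset.sum_congr rfl fun I _ => ?_
  by_cases h1 : I ∈ E <;> by_cases h2 : x ∈ (I : Set ℝ) <;> simp [h1, h2]

/-- Tonelli. The factor `b I` varies with the point because the power induction inserts a power of
the sum below `I` there. -/
theorem setLIntegral_pileSum_below (a : L.Ix → ℝ≥0∞) (b : L.Ix → ℝ → ℝ≥0∞)
    (hb : ∀ I, Measurable (b I)) (J : L.Ix) :
    ∫⁻ x in (J : Set ℝ), L.pileSum (fun I => a I * b I x) (L.below J) x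
      = ∑' I : L.below J, a I * ∫⁻ x in (I : Set ℝ), b I x := by
  have h (I : L.below J) (x : ℝ) : (I : Set ℝ).indicator (fun _ => a I * b I x) x
      = (I : Set ℝ).indicator (fun x => a I * b I x) x := by
    by_cases hx : x ∈ (I : Set ℝ) <;> simp [hx]
  unfold pileSum
  simp_rw [h]
  rw [lintegral_tsum (f := fun I : L.below J => (I : Set ℝ).indicator fun x => a I * b I x)
    fun I => (((hb I).const_mul _).indicator (L.measurableSet_ix I)).aemeasurable]
  refine tsum_congr fun I => ?_
  rw [lintegral_indicator (L.measurableSet_ix I), Measure.restrict_restrict (L.measurableSet_ix I),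
    inter_eq_self_of_subset_left I.2, lintegral_const_mul _ (hb I)]

theorem setLIntegral_pileSum_below_const (a : L.Ix → ℝ≥0∞) (J : L.Ix) :
    ∫⁻ x in (J : Set ℝ), L.pileSum a (L.below J) x
      = ∑' I : L.below J, a I * volume (I : Set ℝ) := by
  simpa using L.setLIntegral_pileSum_below a (fun _ _ => 1) (fun _ => measurable_const) J

/-! ### Integrals of powers: the John–Nirenberg induction -/

theorem _root_.ENNReal.add_pow_succ_le (a b : ℝ≥0∞) (n : ℕ) :
    (a + b) ^ (n + 1) ≤ b ^ (n + 1) + (n + 1) * (a * (a + b) ^ n) := by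
  induction n with
  | zero => simp [add_comm]
  | succ n ih =>
    calc (a + b) ^ (n + 1 + 1) = a * (a + b) ^ (n + 1) + b * (a + b) ^ (n + 1) := by ring
      _ ≤ a * (a + b) ^ (n + 1) + b * (b ^ (n + 1) + (n + 1) * (a * (a + b) ^ n)) := by gcongr
      _ = b ^ (n + 1 + 1) + a * (a + b) ^ (n + 1) + (n + 1) * (a * (b * (a + b) ^ n)) := by ring
      _ ≤ b ^ (n + 1 + 1) + a * (a + b) ^ (n + 1)
          + (n + 1) * (a * ((a + b) * (a + b) ^ n)) := by gcongr; exact le_add_self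
      _ = b ^ (n + 1 + 1) + ((n + 1 : ℕ) + 1) * (a * (a + b) ^ (n + 1)) := by
        push_cast; ring

/-- Peel off the largest interval `I`: the increment of the power is at most `n + 1` times `a I`
times the `n`-th power of the whole sum, and that sum runs over intervals inside `I`. This is a
discrete form of `d(S ^ (n+1)) = (n+1) S ^ n dS`. -/
theorem sum_pow_succ_le (a : L.Ix → ℝ≥0∞) (n : ℕ) {x : ℝ} (F : Finset L.Ix)
    (hF : ∀ I ∈ F, x ∈ (I : Set ℝ)) :
    (∑ I ∈ F, a I) ^ (n + 1) ≤ (n + 1) * ∑ I ∈ F, a I * L.pileSum a (L.below I) x ^ n := by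
  classical
  induction F using Finset.strongInduction with
  | H F ih =>
    rcases F.eq_empty_or_nonempty with rfl | hne
    · simp
    obtain ⟨I, hI, hmax⟩ := L.exists_largest hne hF
    have hle : a I + ∑ K ∈ F.erase I, a K ≤ L.pileSum a (L.below I) x := by
      rw [Finset.add_sum_erase _ _ hI]
      exact L.sum_le_pileSum a fun K hK => ⟨hmax K hK, hF K hK⟩
    rw [← Finset.add_sum_erase _ _ hI,
      ← Finset.add_sum_erase F (fun K => a K * L.pileSum a (L.below K) x ^ n) hI, mul_add, add_comm
      ((n + 1 : ℝ≥0∞) * _)]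
    refine (ENNReal.add_pow_succ_le _ _ n).trans (add_le_add ?_ ?_)
    · exact ih _ (Finset.erase_ssubset hI) fun K hK => hF K (Finset.mem_of_mem_erase hK)
    · gcongr

theorem pileSum_pow_succ_le (a : L.Ix → ℝ≥0∞) (n : ℕ) (E : Set L.Ix) (x : ℝ) :
    L.pileSum a E x ^ (n + 1)
      ≤ (n + 1) * L.pileSum (fun I => a I * L.pileSum a (L.below I) x ^ n) E x := by
  have hn : (0 : ℝ) < (n + 1 : ℕ) := by positivity
  -- Taking the root leaves the bare sum on the left, so that it suffices to bound finite partial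
  -- sums.
  rw [← ENNReal.rpow_natCast, ← ENNReal.le_rpow_inv_iff hn]
  refine L.pileSum_le_of_forall_sum_le fun F hF => ?_
  rw [ENNReal.le_rpow_inv_iff hn, ENNReal.rpow_natCast]
  refine (L.sum_pow_succ_le a n F fun I hI => (hF I hI).2).trans ?_
  gcongr
  exact L.sum_le_pileSum (fun I => a I * L.pileSum a (L.below I) x ^ n) hF

/-- Each step applies the induction hypothesis inside every `I ⊆ J` and then the case of exponent
one on `J`; the factors `n + 1` build the factorial. -/
theorem setLIntegral_pileSum_pow_le {a : L.Ix → ℝ≥0∞} {N : ℝ≥0∞}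
    (h : ∀ J : L.Ix, ∫⁻ x in (J : Set ℝ), L.pileSum a (L.below J) x ≤ N * volume (J : Set ℝ))
    (n : ℕ) (J : L.Ix) :
    ∫⁻ x in (J : Set ℝ), L.pileSum a (L.below J) x ^ n
      ≤ n.factorial * N ^ n * volume (J : Set ℝ) := by
  induction n generalizing J with
  | zero => simp
  | succ n ih =>
    calc ∫⁻ x in (J : Set ℝ), L.pileSum a (L.below J) x ^ (n + 1)
        ≤ ∫⁻ x in (J : Set ℝ), (n + 1) *
            L.pileSum (fun I => a I * L.pileSum a (L.below I) x ^ n) (L.below J) x :=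
          lintegral_mono fun x => L.pileSum_pow_succ_le a n _ x
      _ = (n + 1) * ∑' I : L.below J,
            a I * ∫⁻ x in (I : Set ℝ), L.pileSum a (L.below I) x ^ n := by
          rw [lintegral_const_mul' _ _ (by finiteness), L.setLIntegral_pileSum_below a
            (fun I x => L.pileSum a (L.below I) x ^ n)
            fun I => (L.measurable_pileSum a _).pow_const n]
      _ ≤ (n + 1) * ∑' I : L.below J, a I * (n.factorial * N ^ n * volume (I : Set ℝ)) := by
          gcongr with I
          exact ih I
      _ = (n + 1) * (n.factorial * N ^ n * ∑' I : L.below J, a I * volume (I : Set ℝ)) := by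
          rw [← ENNReal.tsum_mul_left (a := n.factorial * N ^ n)]
          congr 1
          exact tsum_congr fun I => by ring
      _ ≤ (n + 1) * (n.factorial * N ^ n * (N * volume (J : Set ℝ))) := by
          rw [← L.setLIntegral_pileSum_below_const]
          gcongr
          exact h J
      _ = (n + 1).factorial * N ^ (n + 1) * volume (J : Set ℝ) := by
          rw [Nat.factorial_succ]; push_cast; ring

/-! ### Good parts of intervals -/

/-- The part of `I` where the sum of `a` over the subintervals of `I` is at most `c`. -/
def goodPart (a : L.Ix → ℝ≥0∞) (c : ℝ≥0∞) (I : L.Ix) : Set ℝ :=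
  I ∩ {x | L.pileSum a (L.below I) x ≤ c}

theorem measurableSet_goodPart (a : L.Ix → ℝ≥0∞) (c : ℝ≥0∞) (I : L.Ix) :
    MeasurableSet (L.goodPart a c I) :=
  (L.measurableSet_ix I).inter (measurableSet_le (L.measurable_pileSum a _) measurable_const)

/-- Among finitely many intervals whose good parts contain `x`, the largest one contains the others,
so its own goodness at `x` bounds the whole sum. -/
theorem tsum_indicator_goodPart_le (a : L.Ix → ℝ≥0∞) (c : ℝ≥0∞) (x : ℝ) :
    ∑' I : L.Ix, (L.goodPart a c I).indicator (fun _ => a I) x ≤ c := by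
  classical
  rw [ENNReal.tsum_eq_iSup_sum]
  refine iSup_le fun F => ?_
  simp_rw [indicator_apply]
  rw [← Finset.sum_filter]
  set F' := F.filter fun I => x ∈ L.goodPart a c I with hF'
  rcases F'.eq_empty_or_nonempty with h | hne
  · simp [h]
  have hx : ∀ I ∈ F', x ∈ L.goodPart a c I := fun I hI => (Finset.mem_filter.1 hI).2
  obtain ⟨I, hI, hmax⟩ := L.exists_largest hne fun I hI => (hx I hI).1
  exact (L.sum_le_pileSum a fun K hK => ⟨hmax K hK, (hx K hK).1⟩).trans (hx I hI).2

theorem volume_le_two_mul_goodPart {a : L.Ix → ℝ≥0∞} {c : ℝ≥0∞} {I : L.Ix}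
    (h : volume ((I : Set ℝ) ∩ {x | c < L.pileSum a (L.below I) x}) ≤ volume (I : Set ℝ) / 2) :
    volume (I : Set ℝ) ≤ 2 * volume (L.goodPart a c I) := by
  have hsplit : volume (I : Set ℝ) ≤ volume (L.goodPart a c I) + volume (I : Set ℝ) / 2 := by
    refine le_trans (le_trans (measure_mono fun x hx => ?_) (measure_union_le _ _))
      (add_le_add_right h _)
    rcases le_or_gt (L.pileSum a (L.below I) x) c with h | h
    · exact Or.inl ⟨hx, h⟩
    · exact Or.inr ⟨hx, h⟩
  have hfin : volume (I : Set ℝ) / 2 ≠ ∞ := by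
    have := L.volume_ix_ne_top I
    finiteness
  have : volume (I : Set ℝ) / 2 ≤ volume (L.goodPart a c I) := by
    refine (ENNReal.add_le_add_iff_right hfin).1 ?_
    rwa [ENNReal.add_halves]
  calc volume (I : Set ℝ) = 2 * (volume (I : Set ℝ) / 2) :=
        (ENNReal.mul_div_cancel two_ne_zero ENNReal.ofNat_ne_top).symm
    _ ≤ _ := by gcongr

/-- The weights `b` need not be the `a` defining the good parts: norm comparison takes `a` cut off
below `J`, duality takes `‖f I‖ₑ * ‖g I‖ₑ`. -/
theorem tsum_mul_volume_le_goodPart {a : L.Ix → ℝ≥0∞} {c : ℝ≥0∞}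
    (h : ∀ I : L.Ix, volume ((I : Set ℝ) ∩ {x | c < L.pileSum a (L.below I) x})
      ≤ volume (I : Set ℝ) / 2) {b : L.Ix → ℝ≥0∞} {T : Set ℝ}
    (hT : ∀ I : L.Ix, b I ≠ 0 → (I : Set ℝ) ⊆ T) :
    ∑' I : L.Ix, b I * volume (I : Set ℝ)
      ≤ 2 * ∫⁻ x in T, ∑' I : L.Ix, (L.goodPart a c I).indicator (fun _ => b I) x := by
  rw [lintegral_tsum fun I =>
    (measurable_const.indicator (L.measurableSet_goodPart a c I)).aemeasurable,
    ← ENNReal.tsum_mul_left]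
  refine ENNReal.tsum_le_tsum fun I => ?_
  by_cases hI : b I = 0
  · simp [hI]
  rw [lintegral_indicator_const (L.measurableSet_goodPart a c I),
    Measure.restrict_apply (L.measurableSet_goodPart a c I),
    inter_eq_self_of_subset_left (s := L.goodPart a c I) (inter_subset_left.trans (hT I hI)),
    mul_left_comm]
  gcongr
  exact L.volume_le_two_mul_goodPart (h I)

theorem setLIntegral_pileSum_below_le {a : L.Ix → ℝ≥0∞} {c : ℝ≥0∞}
    (h : ∀ I : L.Ix, volume ((I : Set ℝ) ∩ {x | c < L.pileSum a (L.below I) x})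
      ≤ volume (I : Set ℝ) / 2) (J : L.Ix) :
    ∫⁻ x in (J : Set ℝ), L.pileSum a (L.below J) x ≤ 2 * c * volume (J : Set ℝ) := by
  classical
  rw [setLIntegral_pileSum_below_const,
    tsum_subtype (L.below J) fun I : L.Ix => a I * volume (I : Set ℝ)]
  calc ∑' I : L.Ix, (L.below J).indicator (fun I : L.Ix => a I * volume (I : Set ℝ)) I
      = ∑' I : L.Ix, (L.below J).indicator a I * volume (I : Set ℝ) :=
        tsum_congr fun I => by by_cases hI : I ∈ L.below J <;> simp [hI]
    _ ≤ 2 * ∫⁻ x in (J : Set ℝ), ∑' I : L.Ix,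
          (L.goodPart a c I).indicator (fun _ => (L.below J).indicator a I) x :=
        L.tsum_mul_volume_le_goodPart h fun I hI => by
          by_contra hn
          exact hI (indicator_of_notMem (s := L.below J) hn a)
    _ ≤ 2 * ∫⁻ _ in (J : Set ℝ), c := by
        gcongr with x
        refine le_trans (ENNReal.tsum_le_tsum fun I => ?_) (L.tsum_indicator_goodPart_le a c x)
        exact indicator_le_indicator (indicator_le_self _ _ _)
    _ = 2 * c * volume (J : Set ℝ) := by rw [setLIntegral_const, mul_assoc]

end IntervalLattice

/-! ### Independence of the exponent `r` -/

namespace IntervalLattice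

variable (L : IntervalLattice) {𝕜 : Type*} [RCLike 𝕜]

theorem sqFun_eq_pileSum (q : ℝ) (E : Set L.Ix) (s : L.Ix → 𝕜) (x : ℝ) :
    L.sqFun q E s x = L.pileSum (fun I => ‖s I‖ₑ ^ q) E x ^ (1 / q) := rfl

theorem sqFun_rpow_self {q : ℝ} (hq : 0 < q) (E : Set L.Ix) (s : L.Ix → 𝕜) (x : ℝ) :
    L.sqFun q E s x ^ q = L.pileSum (fun I => ‖s I‖ₑ ^ q) E x := by
  rw [sqFun_eq_pileSum, ← ENNReal.rpow_mul, one_div_mul_cancel hq.ne', ENNReal.rpow_one]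

section gInfNorm

variable {q r : ℝ} [Fact (1 ≤ q)] [hr : Fact (1 ≤ r)]

theorem setLIntegral_sqFun_le (s : L.Ix → 𝕜) (J : L.Ix) :
    ∫⁻ x in (J : Set ℝ), L.sqFun q (L.below J) s x ^ r
      ≤ (L.gInfNorm 𝕜 q r).toFun s ^ r * volume (J : Set ℝ) := by
  have hr0 : 0 < r := by linarith [hr.out]
  have h : (⨍⁻ x in (J : Set ℝ), L.sqFun q (L.below J) s x ^ r ∂volume) ^ (1 / r)
      ≤ (L.gInfNorm 𝕜 q r).toFun s :=
    le_iSup (fun J : L.Ix => (⨍⁻ x in (J : Set ℝ),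
      L.sqFun q {I | (I : Set ℝ) ⊆ J} s x ^ r ∂volume) ^ (1 / r)) J
  rwa [one_div, ENNReal.rpow_inv_le_iff hr0, setLAverage_eq,
    ENNReal.div_le_iff (L.volume_ix_ne_zero J) (L.volume_ix_ne_top J)] at h

theorem gInfNorm_le {s : L.Ix → 𝕜} {M : ℝ≥0∞}
    (h : ∀ J : L.Ix, ∫⁻ x in (J : Set ℝ), L.sqFun q (L.below J) s x ^ r
      ≤ M ^ r * volume (J : Set ℝ)) : (L.gInfNorm 𝕜 q r).toFun s ≤ M := by
  have hr0 : 0 < r := by linarith [hr.out]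
  refine iSup_le fun J => ?_
  rw [one_div, ENNReal.rpow_inv_le_iff hr0, setLAverage_eq,
    ENNReal.div_le_iff (L.volume_ix_ne_zero J) (L.volume_ix_ne_top J)]
  exact h J

/-- Chebyshev at height `2 * N`: the exceptional set has at most the fraction `2 ^ (-r) ≤ 1 / 2` of
`J`, since `1 ≤ r`. -/
theorem volume_lt_pileSum_le_half {s : L.Ix → 𝕜} (h0 : (L.gInfNorm 𝕜 q r).toFun s ≠ 0)
    (ht : (L.gInfNorm 𝕜 q r).toFun s ≠ ∞) (J : L.Ix) :
    volume ((J : Set ℝ) ∩ {x | (2 * (L.gInfNorm 𝕜 q r).toFun s) ^ q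
      < L.pileSum (fun I => ‖s I‖ₑ ^ q) (L.below J) x}) ≤ volume (J : Set ℝ) / 2 := by
  have hq0 : 0 < q := by linarith [(inferInstance : Fact (1 ≤ q)).out]
  have hr0 : 0 < r := by linarith [hr.out]
  set N := (L.gInfNorm 𝕜 q r).toFun s with hN
  set m := volume ((J : Set ℝ) ∩ {x | (2 * N) ^ q
      < L.pileSum (fun I => ‖s I‖ₑ ^ q) (L.below J) x})
  have hNr0 : N ^ r ≠ 0 := by simp [ENNReal.rpow_eq_zero_iff, h0, ht]
  have hNrt : N ^ r ≠ ∞ := ENNReal.rpow_ne_top_of_nonneg hr0.le ht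
  have h2 : (2 : ℝ≥0∞) ≤ 2 ^ r := by
    simpa using ENNReal.rpow_le_rpow_of_exponent_le (x := 2) (by norm_num) hr.out
  have key : N ^ r * (2 * m) ≤ N ^ r * volume (J : Set ℝ) := by
    calc N ^ r * (2 * m) = 2 * N ^ r * m := by ring
      _ ≤ (2 * N) ^ r * (volume.restrict (J : Set ℝ))
            {x | (2 * N) ^ r ≤ L.sqFun q (L.below J) s x ^ r} := by
          rw [Measure.restrict_apply
            (measurableSet_le measurable_const ((L.measurable_sqFun q _ s).pow_const r))]
          refine mul_le_mul' ?_ (measure_mono ?_)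
          · rw [ENNReal.mul_rpow_of_nonneg _ _ hr0.le]
            gcongr
          rintro x ⟨hxJ, hx⟩
          refine ⟨?_, hxJ⟩
          rw [mem_ofPred_eq, ← L.sqFun_rpow_self hq0] at hx
          exact ENNReal.rpow_le_rpow ((ENNReal.rpow_lt_rpow_iff hq0).1 hx).le hr0.le
      _ ≤ ∫⁻ x in (J : Set ℝ), L.sqFun q (L.below J) s x ^ r :=
          mul_meas_ge_le_lintegral₀ ((L.measurable_sqFun q _ s).pow_const r).aemeasurable _
      _ ≤ N ^ r * volume (J : Set ℝ) := L.setLIntegral_sqFun_le s J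
  rw [ENNReal.mul_le_mul_iff_right hNr0 hNrt] at key
  rwa [ENNReal.le_div_iff_mul_le (by simp) (by simp), mul_comm]

theorem gInfNorm_self_le (s : L.Ix → 𝕜) :
    (L.gInfNorm 𝕜 q q).toFun s ≤ 4 * (L.gInfNorm 𝕜 q r).toFun s := by
  have hq1 : 1 ≤ q := (inferInstance : Fact (1 ≤ q)).out
  have hq0 : 0 < q := by linarith
  rcases eq_or_ne ((L.gInfNorm 𝕜 q r).toFun s) 0 with h0 | h0
  · rw [(L.gInfNorm 𝕜 q r).eq_zero' s h0, SeqENorm.map_zero']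
    exact bot_le
  rcases eq_or_ne ((L.gInfNorm 𝕜 q r).toFun s) ∞ with ht | ht
  · rw [ht, ENNReal.mul_top (by norm_num)]
    exact le_top
  refine L.gInfNorm_le fun J => ?_
  simp_rw [L.sqFun_rpow_self hq0]
  refine (L.setLIntegral_pileSum_below_le (L.volume_lt_pileSum_le_half h0 ht) J).trans ?_
  gcongr
  have h2 : (2 : ℝ≥0∞) ≤ 2 ^ q := by
    simpa using ENNReal.rpow_le_rpow_of_exponent_le (x := 2) (by norm_num) hq1
  -- The good-part bound gives `2 * (2 * N) ^ q`, which is at most `(4 * N) ^ q` because `2 ≤ 2 ^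
  -- q`.
  have h4 : (4 : ℝ≥0∞) * (L.gInfNorm 𝕜 q r).toFun s
      = 2 * (2 * (L.gInfNorm 𝕜 q r).toFun s) := by
    rw [← mul_assoc]; norm_num
  rw [h4, ENNReal.mul_rpow_of_nonneg 2 (2 * _) hq0.le]
  gcongr

theorem gInfNorm_mono_exponent {t : ℝ} [Fact (1 ≤ t)] (hrt : r ≤ t) (s : L.Ix → 𝕜) :
    (L.gInfNorm 𝕜 q r).toFun s ≤ (L.gInfNorm 𝕜 q t).toFun s := by
  have hr0 : 0 < r := by linarith [hr.out]
  refine iSup_mono fun J => ?_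
  set ν : Measure ℝ :=
    (volume.restrict (J : Set ℝ) univ)⁻¹ • volume.restrict (J : Set ℝ) with hν
  have : IsProbabilityMeasure ν := by
    constructor
    rw [hν, Measure.smul_apply, Measure.restrict_apply_univ, smul_eq_mul,
      ENNReal.inv_mul_cancel (L.volume_ix_ne_zero J) (L.volume_ix_ne_top J)]
  exact eLpNorm'_le_eLpNorm'_of_exponent_le hr0 hrt ν
    (L.measurable_sqFun q {I | (I : Set ℝ) ⊆ J} s).aestronglyMeasurable

theorem gInfNorm_le_factorial_mul {n : ℕ} (hrn : r ≤ n * q) (s : L.Ix → 𝕜) :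
    (L.gInfNorm 𝕜 q r).toFun s ≤ n.factorial * (L.gInfNorm 𝕜 q q).toFun s := by
  have hq1 : 1 ≤ q := (inferInstance : Fact (1 ≤ q)).out
  have hq0 : 0 < q := by linarith
  have hnq : 1 ≤ n * q := hr.out.trans hrn
  have : Fact (1 ≤ n * q) := ⟨hnq⟩
  refine (L.gInfNorm_mono_exponent hrn s).trans (L.gInfNorm_le fun J => ?_)
  have h (J : L.Ix) : ∫⁻ x in (J : Set ℝ), L.pileSum (fun I => ‖s I‖ₑ ^ q) (L.below J) x
      ≤ (L.gInfNorm 𝕜 q q).toFun s ^ q * volume (J : Set ℝ) := by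
    simpa only [L.sqFun_rpow_self hq0] using L.setLIntegral_sqFun_le (q := q) (r := q) s J
  have hpow (y : ℝ≥0∞) : y ^ (n * q) = (y ^ q) ^ n := by
    rw [mul_comm, ENNReal.rpow_mul, ENNReal.rpow_natCast]
  -- A crude loss: the root of order `n * q` of the factorial would do, but only finiteness of the
  -- constant matters.
  have hfac : (n.factorial : ℝ≥0∞) ≤ (n.factorial : ℝ≥0∞) ^ (n * q) := by
    have h1 : (1 : ℝ≥0∞) ≤ n.factorial := by exact_mod_cast n.factorial_pos
    simpa using ENNReal.rpow_le_rpow_of_exponent_le h1 hnq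
  rw [ENNReal.mul_rpow_of_nonneg _ _ (zero_le_one.trans hnq)]
  simp_rw [hpow ((L.gInfNorm 𝕜 q q).toFun s), hpow (L.sqFun _ _ _ _), L.sqFun_rpow_self hq0]
  refine (L.setLIntegral_pileSum_pow_le h n J).trans ?_
  gcongr

end gInfNorm

variable (𝕜) in
theorem exists_gInfNorm_le (q r t : ℝ) [Fact (1 ≤ q)] [Fact (1 ≤ r)] [Fact (1 ≤ t)] :
    ∃ C : ℝ≥0, 0 < C ∧ ∀ (L : IntervalLattice) (s : L.Ix → 𝕜),
      (L.gInfNorm 𝕜 q r).toFun s ≤ C * (L.gInfNorm 𝕜 q t).toFun s := by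
  have hq1 : 1 ≤ q := (inferInstance : Fact (1 ≤ q)).out
  have hr1 : 1 ≤ r := (inferInstance : Fact (1 ≤ r)).out
  refine ⟨⌈r⌉₊.factorial * 4, by positivity, fun L s => ?_⟩
  have hrn : r ≤ ⌈r⌉₊ * q :=
    (Nat.le_ceil r).trans (le_mul_of_one_le_right (Nat.cast_nonneg _) hq1)
  refine (L.gInfNorm_le_factorial_mul hrn s).trans ?_
  push_cast
  rw [mul_assoc]
  gcongr
  exact L.gInfNorm_self_le s

end IntervalLattice

/-! ### The pairing and its boundedness -/

namespace SeqENorm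

variable {𝕜 : Type*} [RCLike 𝕜] {ι : Type*} (N : SeqENorm 𝕜 ι)

/-- The sequence underlying an element of the space of a norm. -/
def toSeq : N.Space →ₗ[𝕜] (ι → 𝕜) := N.finite.subtype

theorem enorm_eq (f : N.Space) : ‖f‖ₑ = N.toFun f := by
  rw [← ofReal_norm]
  exact ENNReal.ofReal_toReal f.2.ne

end SeqENorm

namespace IntervalLattice

variable (L : IntervalLattice) {𝕜 : Type*} [RCLike 𝕜] {q q' : ℝ}

theorem restrict_carrier_ix (I : L.Ix) :
    volume.restrict L.carrier (I : Set ℝ) = volume (I : Set ℝ) := by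
  rw [Measure.restrict_apply (L.measurableSet_ix I),
    inter_eq_self_of_subset_left (L.ix_subset_carrier I)]

theorem setIntegral_carrier_indicator_const {E : Type*} [NormedAddCommGroup E] [NormedSpace ℝ E]
    [CompleteSpace E] (I : L.Ix) (c : E) :
    ∫ x in L.carrier, (I : Set ℝ).indicator (fun _ => c) x = (volume (I : Set ℝ)).toReal • c := by
  rw [integral_indicator_const _ (L.measurableSet_ix I), Measure.real, L.restrict_carrier_ix]

theorem setIntegral_tsum_indicator {u : L.Ix → 𝕜}
    (hu : Summable fun I : L.Ix => u I * ((volume (I : Set ℝ)).toReal : 𝕜)) :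
    ∫ x in L.carrier, ∑' I : L.Ix, (I : Set ℝ).indicator (fun _ => u I) x
      = ∑' I : L.Ix, u I * ((volume (I : Set ℝ)).toReal : 𝕜) := by
  have hint (I : L.Ix) : Integrable ((I : Set ℝ).indicator fun _ => u I)
      (volume.restrict L.carrier) :=
    (integrable_indicator_iff (L.measurableSet_ix I)).2
      (integrableOn_const (by rw [L.restrict_carrier_ix]; exact L.volume_ix_ne_top I))
  have hnorm (I : L.Ix) : ∫ x in L.carrier, ‖(I : Set ℝ).indicator (fun _ => u I) x‖
      = ‖u I * ((volume (I : Set ℝ)).toReal : 𝕜)‖ := by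
    simp_rw [norm_indicator_eq_indicator_norm]
    rw [L.setIntegral_carrier_indicator_const, norm_mul, RCLike.norm_ofReal,
      abs_of_nonneg ENNReal.toReal_nonneg, smul_eq_mul, mul_comm]
  have hsum : Summable fun I : L.Ix =>
      ∫ x in L.carrier, ‖(I : Set ℝ).indicator (fun _ => u I) x‖ := by
    simp_rw [hnorm]
    -- Summability of scalars is already absolute, which permits exchanging sum and integral.
    exact hu.norm
  rw [← (hasSum_integral_of_summable_integral_norm hint hsum).tsum_eq]
  refine tsum_congr fun I => ?_
  rw [L.setIntegral_carrier_indicator_const, RCLike.real_smul_eq_coe_mul, mul_comm]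

/-- Hölder for the sum at a fixed point. Only the factor of `g` keeps the restriction to good parts,
where its `q'`-sum is at most `c`. -/
theorem tsum_indicator_goodPart_mul_le (hqq' : q.HolderConjugate q') (f g : L.Ix → 𝕜)
    (c : ℝ≥0∞) (x : ℝ) :
    ∑' I : L.Ix, (L.goodPart (fun I => ‖g I‖ₑ ^ q') c I).indicator
      (fun _ => ‖f I‖ₑ * ‖g I‖ₑ) x ≤ L.sqFun q univ f x * c ^ (1 / q') := by
  set A := L.goodPart (fun I => ‖g I‖ₑ ^ q') c with hA
  have hu (I : L.Ix) : ((I : Set ℝ).indicator (fun _ => ‖f I‖ₑ) x) ^ q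
      = (I : Set ℝ).indicator (fun _ => ‖f I‖ₑ ^ q) x := by
    by_cases hx : x ∈ (I : Set ℝ) <;> simp [hx, hqq'.pos]
  have hv (I : L.Ix) : ((A I).indicator (fun _ => ‖g I‖ₑ) x) ^ q'
      = (A I).indicator (fun _ => ‖g I‖ₑ ^ q') x := by
    by_cases hx : x ∈ A I <;> simp [hx, hqq'.symm.pos]
  rw [ENNReal.tsum_eq_iSup_sum]
  refine iSup_le fun F => ?_
  calc ∑ I ∈ F, (A I).indicator (fun _ => ‖f I‖ₑ * ‖g I‖ₑ) x
      = ∑ I ∈ F, (I : Set ℝ).indicator (fun _ => ‖f I‖ₑ) x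
          * (A I).indicator (fun _ => ‖g I‖ₑ) x := by
        refine Finset.sum_congr rfl fun I _ => ?_
        by_cases hx : x ∈ A I
        · simp [hx, (hx.1 : x ∈ (I : Set ℝ))]
        · simp [hx]
    _ ≤ _ := ENNReal.inner_le_Lp_mul_Lq F _ _ hqq'
    _ ≤ _ := by
        simp_rw [hu, hv]
        refine mul_le_mul' (ENNReal.rpow_le_rpow ?_ hqq'.one_div_nonneg)
          (ENNReal.rpow_le_rpow ?_ hqq'.symm.one_div_nonneg)
        · rw [tsum_univ fun I : L.Ix => (I : Set ℝ).indicator (fun _ => ‖f I‖ₑ ^ q) x]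
          exact ENNReal.sum_le_tsum F
        · exact (ENNReal.sum_le_tsum F).trans (L.tsum_indicator_goodPart_le _ c x)

variable [Fact (1 ≤ q)] [Fact (1 ≤ q')]

theorem gNorm_one (f : L.Ix → 𝕜) :
    (L.gNorm 𝕜 1 q).toFun f = ∫⁻ x in L.carrier, L.sqFun q univ f x := by
  simp [gNorm]

theorem tsum_mul_volume_le (hqq' : q.HolderConjugate q') (f : L.Ix → 𝕜) {g : L.Ix → 𝕜}
    (hg : (L.gInfNorm 𝕜 q' q').toFun g ≠ ∞) :
    ∑' I : L.Ix, ‖f I‖ₑ * ‖g I‖ₑ * volume (I : Set ℝ)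
      ≤ 4 * (L.gInfNorm 𝕜 q' q').toFun g * (L.gNorm 𝕜 1 q).toFun f := by
  rcases eq_or_ne ((L.gInfNorm 𝕜 q' q').toFun g) 0 with h0 | h0
  · have := (L.gInfNorm 𝕜 q' q').eq_zero' g h0
    simp [this]
  set N := (L.gInfNorm 𝕜 q' q').toFun g with hN
  have hroot : ((2 * N) ^ q') ^ (1 / q') = 2 * N := by
    rw [← ENNReal.rpow_mul, mul_one_div_cancel hqq'.symm.ne_zero, ENNReal.rpow_one]
  refine (L.tsum_mul_volume_le_goodPart (T := L.carrier) (L.volume_lt_pileSum_le_half h0 hg)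
    fun I _ => L.ix_subset_carrier I).trans ?_
  calc _ ≤ 2 * ∫⁻ x in L.carrier, L.sqFun q univ f x * ((2 * N) ^ q') ^ (1 / q') := by
        gcongr with x
        exact L.tsum_indicator_goodPart_mul_le hqq' f g _ x
    _ = 4 * N * (L.gNorm 𝕜 1 q).toFun f := by
        rw [lintegral_mul_const _ (L.measurable_sqFun q univ f), hroot, gNorm_one,
          show (4 : ℝ≥0∞) = 2 * 2 by norm_num]
        ring

/-- The term of index `I` of the pairing of two sequences. -/
def pairingTerm (f g : L.Ix → 𝕜) (I : L.Ix) : 𝕜 :=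
  f I * g I * ((volume (I : Set ℝ)).toReal : 𝕜)

theorem enorm_pairingTerm (f g : L.Ix → 𝕜) (I : L.Ix) :
    ‖L.pairingTerm f g I‖ₑ = ‖f I‖ₑ * ‖g I‖ₑ * volume (I : Set ℝ) := by
  rw [pairingTerm, enorm_mul, enorm_mul, ← ofReal_norm (((volume (I : Set ℝ)).toReal : 𝕜)),
    RCLike.norm_ofReal, abs_of_nonneg ENNReal.toReal_nonneg,
    ENNReal.ofReal_toReal (L.volume_ix_ne_top I)]

theorem tsum_enorm_pairingTerm_le (hqq' : q.HolderConjugate q') (f : L.G 𝕜 1 q)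
    (g : L.GInf 𝕜 q') : ∑' I, ‖L.pairingTerm f g I‖ₑ ≤ 4 * ‖g‖ₑ * ‖f‖ₑ := by
  simp_rw [enorm_pairingTerm, SeqENorm.enorm_eq]
  exact L.tsum_mul_volume_le hqq' f g.2.ne

theorem tsum_enorm_pairingTerm_ne_top (hqq' : q.HolderConjugate q') (f : L.G 𝕜 1 q)
    (g : L.GInf 𝕜 q') : ∑' I, ‖L.pairingTerm f g I‖ₑ ≠ ∞ :=
  ne_top_of_le_ne_top (by finiteness) (L.tsum_enorm_pairingTerm_le hqq' f g)

theorem summable_pairingTerm (hqq' : q.HolderConjugate q') (f : L.G 𝕜 1 q) (g : L.GInf 𝕜 q') :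
    Summable (L.pairingTerm f g) :=
  (tsum_enorm_ne_top_iff_summable_norm.1 (L.tsum_enorm_pairingTerm_ne_top hqq' f g)).of_norm

/-- The pairing of the spaces of type `(∞, q')` and `(1, q)`, as a bilinear map. -/
def pairingLM (hqq' : q.HolderConjugate q') : L.GInf 𝕜 q' →ₗ[𝕜] L.G 𝕜 1 q →ₗ[𝕜] 𝕜 :=
  LinearMap.mk₂ 𝕜 (fun g f => ∑' I, L.pairingTerm f g I)
    (fun g₁ g₂ f => by
      rw [← (L.summable_pairingTerm hqq' f g₁).tsum_add (L.summable_pairingTerm hqq' f g₂)]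
      refine tsum_congr fun I => ?_
      change f I * (g₁ I + g₂ I) * _ = f I * g₁ I * _ + f I * g₂ I * _
      ring)
    (fun c g f => by
      rw [smul_eq_mul, ← tsum_mul_left]
      refine tsum_congr fun I => ?_
      change f I * (c * g I) * _ = c * (f I * g I * _)
      ring)
    (fun g f₁ f₂ => by
      rw [← (L.summable_pairingTerm hqq' f₁ g).tsum_add (L.summable_pairingTerm hqq' f₂ g)]
      refine tsum_congr fun I => ?_
      change (f₁ I + f₂ I) * g I * _ = f₁ I * g I * _ + f₂ I * g I * _
      ring)
    (fun c g f => by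
      rw [smul_eq_mul, ← tsum_mul_left]
      refine tsum_congr fun I => ?_
      change c * f I * g I * _ = c * (f I * g I * _)
      ring)

/-- The pairing of the spaces of type `(∞, q')` and `(1, q)`, as a map into the dual space. -/
def pairing (hqq' : q.HolderConjugate q') : L.GInf 𝕜 q' →L[𝕜] StrongDual 𝕜 (L.G 𝕜 1 q) :=
  (L.pairingLM hqq').mkContinuous₂ 4 fun g f => by
    have h := (enorm_tsum_le_tsum_enorm (f := L.pairingTerm f g)).trans
      (L.tsum_enorm_pairingTerm_le hqq' f g)
    have h' := ENNReal.toReal_mono (by finiteness) h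
    simpa [ENNReal.toReal_mul, pairingLM] using h'

theorem pairing_apply (hqq' : q.HolderConjugate q') (g : L.GInf 𝕜 q') (f : L.G 𝕜 1 q) :
    L.pairing hqq' g f = ∑' I, L.pairingTerm f g I := rfl

theorem norm_pairing_le (hqq' : q.HolderConjugate q') (g : L.GInf 𝕜 q') :
    ‖L.pairing (𝕜 := 𝕜) hqq' g‖ ≤ 4 * ‖g‖ := by
  have h : ‖L.pairing (𝕜 := 𝕜) hqq'‖ ≤ 4 :=
    LinearMap.mkContinuous₂_norm_le (L.pairingLM (𝕜 := 𝕜) hqq') (by norm_num) _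
  exact (L.pairing (𝕜 := 𝕜) hqq').le_of_opNorm_le h g

theorem setIntegral_tsum_pairing (hqq' : q.HolderConjugate q') (f : L.G 𝕜 1 q)
    (g : L.GInf 𝕜 q') :
    ∫ x in L.carrier, ∑' I : L.Ix, (I : Set ℝ).indicator (fun _ => f I * g I) x
      = ∑' I : L.Ix, L.pairingTerm (f : L.Ix → 𝕜) (g : L.Ix → 𝕜) I :=
  L.setIntegral_tsum_indicator (L.summable_pairingTerm hqq' f g)

end IntervalLattice

/-! ### Representation of functionals -/

namespace IntervalLattice

open Filter Topology

variable (L : IntervalLattice) {𝕜 : Type*} [RCLike 𝕜] {q q' : ℝ} [Fact (1 ≤ q)]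

theorem gNorm_single_lt_top [DecidableEq L.Ix] (hq : 0 < q) (I : L.Ix) :
    (L.gNorm 𝕜 1 q).toFun (Pi.single I 1) < ∞ := by
  have h (x : ℝ) : L.sqFun q univ (Pi.single I (1 : 𝕜)) x
      = (I : Set ℝ).indicator (fun _ => (1 : ℝ≥0∞)) x := by
    rw [sqFun, tsum_univ fun K : L.Ix =>
      (K : Set ℝ).indicator (fun _ => ‖(Pi.single I (1 : 𝕜) : L.Ix → 𝕜) K‖ₑ ^ q) x,
      tsum_eq_single I]
    · by_cases hx : x ∈ (I : Set ℝ) <;> simp [hx, hq]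
    · intro K hK
      simp [hK, hq]
  rw [gNorm_one]
  simp_rw [h]
  rw [lintegral_indicator_const (L.measurableSet_ix I), one_mul]
  exact (Measure.restrict_apply_le _ _).trans_lt (L.volume_ix_ne_top I).lt_top

open Classical in
variable (𝕜) in
/-- The unit sequences. -/
def unitSeq (hq : 0 < q) (I : L.Ix) : L.G 𝕜 1 q :=
  ⟨Pi.single I 1, L.gNorm_single_lt_top hq I⟩

theorem sum_smul_unitSeq_apply (hq : 0 < q) (F : Finset L.Ix) (c : L.Ix → 𝕜) (K : L.Ix) :
    (∑ I ∈ F, c I • L.unitSeq 𝕜 hq I : L.G 𝕜 1 q) K = (F : Set L.Ix).indicator c K := by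
  classical
  change (L.gNorm 𝕜 1 q).toSeq (∑ I ∈ F, c I • L.unitSeq 𝕜 hq I) K = _
  rw [map_sum, Finset.sum_apply]
  have h (I : L.Ix) : (L.gNorm 𝕜 1 q).toSeq (c I • L.unitSeq 𝕜 hq I) K
      = if K = I then c I else 0 := by
    rw [map_smul, Pi.smul_apply]
    change c I • (Pi.single I (1 : 𝕜) : L.Ix → 𝕜) K = _
    by_cases hKI : K = I
    · subst hKI; simp
    · simp [hKI]
  simp_rw [h]
  by_cases hK : K ∈ F <;> simp [hK]

theorem sqFun_indicator {q : ℝ} (hq : 0 < q) (E : Set L.Ix) (s : L.Ix → 𝕜) (x : ℝ) :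
    L.sqFun q univ (E.indicator s) x = L.sqFun q E s x := by
  simp only [sqFun_eq_pileSum, pileSum_eq_tsum]
  congr 1
  refine tsum_congr fun I => ?_
  by_cases hI : I ∈ E <;> simp [hI, hq]

/-- Dominated convergence: at almost every point the `q`-sum of `f` is finite, so its tails tend to
zero, and `L.sqFun q univ f` is an integrable majorant. -/
theorem tendsto_sum_smul_unitSeq (hq : 0 < q) (f : L.G 𝕜 1 q) :
    Tendsto (fun F : Finset L.Ix => ∑ I ∈ F, f I • L.unitSeq 𝕜 hq I) atTop (𝓝 f) := by
  rw [tendsto_iff_enorm_sub_tendsto_zero]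
  have hsub (F : Finset L.Ix) : ‖∑ I ∈ F, f I • L.unitSeq 𝕜 hq I - f‖ₑ
      = ∫⁻ x in L.carrier, L.sqFun q (F : Set L.Ix)ᶜ f x := by
    rw [← enorm_neg, neg_sub, SeqENorm.enorm_eq, gNorm_one]
    have heq : (f - ∑ I ∈ F, f I • L.unitSeq 𝕜 hq I : L.G 𝕜 1 q).1
        = ((F : Set L.Ix)ᶜ).indicator f := by
      funext K
      change f K - (∑ I ∈ F, f I • L.unitSeq 𝕜 hq I : L.G 𝕜 1 q) K = _
      rw [sum_smul_unitSeq_apply]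
      by_cases hK : K ∈ F <;> simp [hK]
    rw [heq]
    exact lintegral_congr fun x => L.sqFun_indicator hq _ _ x
  simp_rw [hsub]
  have hfin : ∫⁻ x in L.carrier, L.sqFun q univ f x ≠ ∞ := by
    rw [← gNorm_one]; exact f.2.ne
  rw [← lintegral_zero (μ := volume.restrict L.carrier)]
  refine tendsto_lintegral_filter_of_dominated_convergence (L.sqFun q univ f)
    (Eventually.of_forall fun F => L.measurable_sqFun q _ _)
    (Eventually.of_forall fun F => ae_of_all _ fun x => ?_) hfin ?_
  · rw [← L.sqFun_indicator hq]
    simp only [sqFun_eq_pileSum, pileSum_eq_tsum]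
    refine ENNReal.rpow_le_rpow (ENNReal.tsum_le_tsum fun I => ?_) (by positivity)
    by_cases hI : I ∈ F <;> simp [hI, hq]
  · filter_upwards [ae_lt_top (L.measurable_sqFun q univ f) hfin] with x hx
    have hx' : ∑' I : L.Ix, (I : Set ℝ).indicator (fun _ => ‖f I‖ₑ ^ q) x ≠ ∞ := by
      intro htop
      rw [sqFun, tsum_univ fun I : L.Ix => (I : Set ℝ).indicator (fun _ => ‖f I‖ₑ ^ q) x, htop,
        ENNReal.top_rpow_of_pos (by positivity)] at hx
      exact lt_irrefl _ hx
    have := ((ENNReal.continuous_rpow_const (y := 1 / q)).tendsto 0).comp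
      (ENNReal.tendsto_tsum_compl_atTop_zero hx')
    rwa [ENNReal.zero_rpow_of_pos (by positivity)] at this

theorem hasSum_dual_apply (hq : 0 < q) (φ : StrongDual 𝕜 (L.G 𝕜 1 q)) {g : L.Ix → 𝕜}
    (hg : ∀ I, φ (L.unitSeq 𝕜 hq I) = g I * ((volume (I : Set ℝ)).toReal : 𝕜))
    (f : L.G 𝕜 1 q) : HasSum (L.pairingTerm f g) (φ f) := by
  have h := (φ.continuous.tendsto f).comp (L.tendsto_sum_smul_unitSeq hq f)
  refine h.congr fun F => ?_
  simp [hg, pairingTerm, mul_assoc]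

/-- Hölder against the constant 1 on `J`, which carries the whole sequence; the `L^q` norm of
`sqFun` then splits into a sum over intervals. -/
theorem gNorm_indicator_le (hqq' : q.HolderConjugate q') {J : L.Ix} {F : Finset L.Ix}
    (hF : ∀ I ∈ F, I ∈ L.below J) (f : L.Ix → 𝕜) :
    (L.gNorm 𝕜 1 q).toFun ((F : Set L.Ix).indicator f)
      ≤ (∑ I ∈ F, ‖f I‖ₑ ^ q * volume (I : Set ℝ)) ^ (1 / q) * volume (J : Set ℝ) ^ (1 / q') := by
  have hq := hqq'.pos
  have hsq (x : ℝ) : L.sqFun q univ ((F : Set L.Ix).indicator f) x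
      = (∑ I ∈ F, (I : Set ℝ).indicator (fun _ => ‖f I‖ₑ ^ q) x) ^ (1 / q) := by
    rw [L.sqFun_indicator hq, sqFun]
    congr 1
    exact Finset.tsum_subtype F fun I : L.Ix => (I : Set ℝ).indicator (fun _ => ‖f I‖ₑ ^ q) x
  have hJ (x : ℝ) (hx : x ∉ (J : Set ℝ)) :
      L.sqFun q univ ((F : Set L.Ix).indicator f) x = 0 := by
    rw [hsq, Finset.sum_eq_zero fun I hI => indicator_of_notMem (fun h => hx (hF I hI h)) _,
      ENNReal.zero_rpow_of_pos (by positivity)]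
  rw [gNorm_one]
  calc ∫⁻ x in L.carrier, L.sqFun q univ ((F : Set L.Ix).indicator f) x
      ≤ ∫⁻ x, L.sqFun q univ ((F : Set L.Ix).indicator f) x := setLIntegral_le_lintegral _ _
    _ = ∫⁻ x in (J : Set ℝ), L.sqFun q univ ((F : Set L.Ix).indicator f) x := by
        rw [← lintegral_indicator (L.measurableSet_ix J)]
        refine lintegral_congr fun x => ?_
        by_cases hx : x ∈ (J : Set ℝ)
        · simp [hx]
        · simp [hx, hJ]
    _ ≤ (∫⁻ x in (J : Set ℝ), L.sqFun q univ ((F : Set L.Ix).indicator f) x ^ q) ^ (1 / q)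
          * (∫⁻ _ in (J : Set ℝ), 1 ^ q') ^ (1 / q') := by
        simpa using ENNReal.lintegral_mul_le_Lp_mul_Lq (volume.restrict (J : Set ℝ)) hqq'
          (L.measurable_sqFun q univ ((F : Set L.Ix).indicator f)).aemeasurable
          (aemeasurable_const (b := (1 : ℝ≥0∞)))
    _ = _ := by
        congr 2
        · simp_rw [hsq, ← ENNReal.rpow_mul, one_div_mul_cancel hq.ne', ENNReal.rpow_one]
          rw [lintegral_finsetSum _ fun I _ => measurable_const.indicator (L.measurableSet_ix I)]
          refine Finset.sum_congr rfl fun I hI => ?_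
          rw [lintegral_indicator_const (L.measurableSet_ix I),
            Measure.restrict_apply (L.measurableSet_ix I),
            inter_eq_self_of_subset_left (s := (I : Set ℝ)) (hF I hI)]
        · simp

theorem sum_rpow_mul_volume_le (hqq' : q.HolderConjugate q') (φ : StrongDual 𝕜 (L.G 𝕜 1 q))
    {g : L.Ix → 𝕜}
    (hg : ∀ I, φ (L.unitSeq 𝕜 hqq'.pos I) = g I * ((volume (I : Set ℝ)).toReal : 𝕜))
    {J : L.Ix} {F : Finset L.Ix} (hF : ∀ I ∈ F, I ∈ L.below J) :
    ∑ I ∈ F, ‖g I‖ₑ ^ q' * volume (I : Set ℝ) ≤ ‖φ‖ₑ ^ q' * volume (J : Set ℝ) := by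
  have hq' := hqq'.symm.pos
  set S := ∑ I ∈ F, ‖g I‖ₑ ^ q' * volume (I : Set ℝ) with hS
  have hS_top : S ≠ ∞ := ENNReal.sum_ne_top.2 fun I _ =>
    ENNReal.mul_ne_top (ENNReal.rpow_ne_top_of_nonneg hq'.le enorm_ne_top) (L.volume_ix_ne_top I)
  -- The equality case of Hölder: both `c I * g I` and `‖c I‖ ^ q` equal `‖g I‖ ^ q'`. Where `g I =
  -- 0` the conjugate makes `c I` vanish, whatever the sign of `q' - 2`.
  set c : L.Ix → 𝕜 := fun I => (starRingEnd 𝕜) (g I) * ((‖g I‖ ^ (q' - 2) : ℝ) : 𝕜) with hc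
  have hcg (I : L.Ix) : c I * g I = ((‖g I‖ ^ q' : ℝ) : 𝕜) := by
    rcases eq_or_ne (g I) 0 with h | h
    · simp [h, hq'.ne']
    · rw [hc, mul_right_comm, RCLike.conj_mul, ← RCLike.ofReal_pow, ← RCLike.ofReal_mul,
        ← Real.rpow_natCast, ← Real.rpow_add (norm_pos_iff.2 h)]
      congr 2
      push_cast
      ring
  have hcn (I : L.Ix) : ‖c I‖ₑ ^ q = ‖g I‖ₑ ^ q' := by
    have h1 : ‖c I‖ = ‖g I‖ ^ (q' - 1) := by
      rcases eq_or_ne (g I) 0 with h | h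
      · simp [hc, h, Real.zero_rpow hqq'.symm.sub_one_ne_zero]
      · rw [hc, norm_mul, RCLike.norm_conj, RCLike.norm_ofReal,
          abs_of_nonneg (Real.rpow_nonneg (norm_nonneg _) _)]
        nth_rw 1 [← Real.rpow_one ‖g I‖]
        rw [← Real.rpow_add (norm_pos_iff.2 h)]
        congr 1
        ring
    rw [← ofReal_norm, h1, ← ofReal_norm,
      ENNReal.ofReal_rpow_of_nonneg (by positivity) hqq'.pos.le,
      ENNReal.ofReal_rpow_of_nonneg (by positivity) hq'.le, ← Real.rpow_mul (norm_nonneg _),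
      hqq'.symm.sub_one_mul_conj]
  have hφ : ‖φ (∑ I ∈ F, c I • L.unitSeq 𝕜 hqq'.pos I)‖ₑ = S := by
    have h1 : φ (∑ I ∈ F, c I • L.unitSeq 𝕜 hqq'.pos I) = ((S.toReal : ℝ) : 𝕜) := by
      rw [map_sum, hS, ENNReal.toReal_sum fun I _ => ENNReal.mul_ne_top
        (ENNReal.rpow_ne_top_of_nonneg hq'.le enorm_ne_top) (L.volume_ix_ne_top I),
        RCLike.ofReal_sum]
      refine Finset.sum_congr rfl fun I _ => ?_
      rw [map_smul, hg, smul_eq_mul, ← mul_assoc, hcg, ← RCLike.ofReal_mul, ENNReal.toReal_mul,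
        ← ENNReal.toReal_rpow, toReal_enorm]
    rw [h1, ← ofReal_norm, RCLike.norm_ofReal, abs_of_nonneg ENNReal.toReal_nonneg,
      ENNReal.ofReal_toReal hS_top]
  have hnorm : ‖∑ I ∈ F, c I • L.unitSeq 𝕜 hqq'.pos I‖ₑ
      ≤ S ^ (1 / q) * volume (J : Set ℝ) ^ (1 / q') := by
    rw [SeqENorm.enorm_eq]
    have h1 : (∑ I ∈ F, c I • L.unitSeq 𝕜 hqq'.pos I : L.G 𝕜 1 q).1
        = (F : Set L.Ix).indicator c := funext (L.sum_smul_unitSeq_apply hqq'.pos F c)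
    rw [h1]
    refine (L.gNorm_indicator_le hqq' hF c).trans ?_
    simp_rw [hcn]
    exact le_rfl
  rcases eq_or_ne S 0 with h0 | h0
  · rw [h0]; exact bot_le
  have hSq0 : S ^ (1 / q) ≠ 0 := by simp [ENNReal.rpow_eq_zero_iff, h0, hS_top]
  have hSqt : S ^ (1 / q) ≠ ∞ := ENNReal.rpow_ne_top_of_nonneg hqq'.one_div_nonneg hS_top
  -- Testing gives `S ≤ ‖φ‖ * S ^ (1 / q) * |J| ^ (1 / q')`. Cancelling `S ^ (1 / q)` needs `S`
  -- finite, hence the finite set `F`.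
  have hfinal : S ^ (1 / q) * S ^ (1 / q')
      ≤ S ^ (1 / q) * (‖φ‖ₑ * volume (J : Set ℝ) ^ (1 / q')) := by
    have hsum : 1 / q + 1 / q' = 1 := by simpa using hqq'.inv_add_inv_eq_one
    rw [← ENNReal.rpow_add _ _ h0 hS_top, hsum, ENNReal.rpow_one, mul_left_comm]
    calc S = ‖φ (∑ I ∈ F, c I • L.unitSeq 𝕜 hqq'.pos I)‖ₑ := hφ.symm
      _ ≤ ‖φ‖ₑ * ‖∑ I ∈ F, c I • L.unitSeq 𝕜 hqq'.pos I‖ₑ := φ.le_opENorm _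
      _ ≤ _ := by gcongr
  rw [ENNReal.mul_le_mul_iff_right hSq0 hSqt] at hfinal
  have := ENNReal.rpow_le_rpow hfinal hq'.le
  rwa [ENNReal.mul_rpow_of_nonneg _ _ hq'.le, ← ENNReal.rpow_mul, ← ENNReal.rpow_mul,
    one_div_mul_cancel hq'.ne', ENNReal.rpow_one, ENNReal.rpow_one] at this

variable [Fact (1 ≤ q')]

theorem gInfNorm_le_enorm_dual (hqq' : q.HolderConjugate q') (φ : StrongDual 𝕜 (L.G 𝕜 1 q))
    {g : L.Ix → 𝕜}
    (hg : ∀ I, φ (L.unitSeq 𝕜 hqq'.pos I) = g I * ((volume (I : Set ℝ)).toReal : 𝕜)) :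
    (L.gInfNorm 𝕜 q' q').toFun g ≤ ‖φ‖ₑ := by
  classical
  refine L.gInfNorm_le fun J => ?_
  simp_rw [L.sqFun_rpow_self hqq'.symm.pos]
  rw [setLIntegral_pileSum_below_const, ENNReal.tsum_eq_iSup_sum]
  refine iSup_le fun F => ?_
  have h := L.sum_rpow_mul_volume_le hqq' φ hg (J := J)
    (F := F.map (Function.Embedding.subtype _)) (by simp +contextual)
  simpa using h

theorem norm_le_norm_pairing (hqq' : q.HolderConjugate q') (g : L.GInf 𝕜 q') :
    ‖g‖ ≤ ‖L.pairing (𝕜 := 𝕜) hqq' g‖ := by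
  classical
  have h : (L.gInfNorm 𝕜 q' q').toFun g ≤ ‖L.pairing (𝕜 := 𝕜) hqq' g‖ₑ := by
    refine L.gInfNorm_le_enorm_dual hqq' _ fun I => ?_
    have hunit (K : L.Ix) : L.unitSeq 𝕜 hqq'.pos I K = (Pi.single I (1 : 𝕜) : L.Ix → 𝕜) K := by
      rw [unitSeq]
    rw [pairing_apply, tsum_eq_single I fun K hK => by simp [pairingTerm, hunit, hK]]
    simp [pairingTerm, hunit]
  rw [← SeqENorm.enorm_eq] at h
  exact enorm_le_iff_norm_le.1 h

theorem pairing_surjective (hqq' : q.HolderConjugate q') :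
    Function.Surjective (L.pairing (𝕜 := 𝕜) hqq') := by
  intro φ
  set g : L.Ix → 𝕜 := fun I => φ (L.unitSeq 𝕜 hqq'.pos I) / ((volume (I : Set ℝ)).toReal : 𝕜)
  have hg (I : L.Ix) : φ (L.unitSeq 𝕜 hqq'.pos I) = g I * ((volume (I : Set ℝ)).toReal : 𝕜) := by
    refine (div_mul_cancel₀ _ ?_).symm
    rw [Ne, RCLike.ofReal_eq_zero]
    exact ENNReal.toReal_ne_zero.2 ⟨L.volume_ix_ne_zero I, L.volume_ix_ne_top I⟩
  refine ⟨⟨g, (L.gInfNorm_le_enorm_dual hqq' φ hg).trans_lt enorm_lt_top⟩, ?_⟩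
  ext f
  exact (L.hasSum_dual_apply hqq'.pos φ hg f).tsum_eq

theorem pairing_injective (hqq' : q.HolderConjugate q') :
    Function.Injective (L.pairing (𝕜 := 𝕜) hqq') := by
  refine (injective_iff_map_eq_zero _).2 fun g hg => ?_
  have h := L.norm_le_norm_pairing hqq' g
  rwa [hg, norm_zero, norm_le_zero_iff] at h

variable (𝕜) in
/-- The space of type `(∞, q')` as the dual of the space of type `(1, q)`. -/
def dualEquiv (hqq' : q.HolderConjugate q') :
    L.GInf 𝕜 q' ≃L[𝕜] StrongDual 𝕜 (L.G 𝕜 1 q) :=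
  (LinearEquiv.ofBijective (L.pairing (𝕜 := 𝕜) hqq').toLinearMap
    -- The 4 comes from the good parts, the 1 from testing on extremal sequences.
    ⟨L.pairing_injective hqq', L.pairing_surjective hqq'⟩).toContinuousLinearEquivOfBounds 4 1
    (L.norm_pairing_le hqq') fun φ => by
      obtain ⟨g, rfl⟩ := L.pairing_surjective hqq' φ
      rw [one_mul]
      refine le_trans (le_of_eq ?_) (L.norm_le_norm_pairing hqq' g)
      exact congrArg norm (LinearEquiv.ofBijective_symm_apply_apply _ g)

theorem dualEquiv_apply (hqq' : q.HolderConjugate q') (g : L.GInf 𝕜 q') :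
    L.dualEquiv 𝕜 hqq' g = L.pairing hqq' g := rfl

end IntervalLattice

theorem mainTheorem7 (𝕜 : Type*) [RCLike 𝕜] (q q' : ℝ) [Fact (1 ≤ q)] [Fact (1 ≤ q')]
    (hq : 1 < q) (hqq' : 1 / q + 1 / q' = 1) :
    (∀ (r₁ r₂ : ℝ) [Fact (1 ≤ r₁)] [Fact (1 ≤ r₂)], ∃ C : ℝ≥0, 0 < C ∧ ∀ L : IntervalLattice,
      (L.gInfNorm 𝕜 q r₁).finite = (L.gInfNorm 𝕜 q r₂).finite ∧
      ∀ s : L.Ix → 𝕜,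
        (L.gInfNorm 𝕜 q r₁).toFun s ≤ C * (L.gInfNorm 𝕜 q r₂).toFun s ∧
        (L.gInfNorm 𝕜 q r₂).toFun s ≤ C * (L.gInfNorm 𝕜 q r₁).toFun s) ∧
    ∃ C : ℝ, 0 < C ∧ ∀ L : IntervalLattice,
      ∃ Φ : L.GInf 𝕜 q' ≃L[𝕜] StrongDual 𝕜 (L.G 𝕜 1 q),
        (∀ (g : L.GInf 𝕜 q') (f : L.G 𝕜 1 q),
          HasSum (fun I : L.Ix => f I * g I * ((volume (I : Set ℝ)).toReal : 𝕜)) (Φ g f) ∧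
          Φ g f = ∫ x in L.carrier, ∑' I : L.Ix, (I : Set ℝ).indicator (fun _ => f I * g I) x) ∧
        ∀ g : L.GInf 𝕜 q', ‖Φ g‖ ≤ C * ‖g‖ ∧ ‖g‖ ≤ C * ‖Φ g‖ := by
  constructor
  · intro r₁ r₂ _ _
    obtain ⟨C₁, hC₁, h₁⟩ := IntervalLattice.exists_gInfNorm_le 𝕜 q r₁ r₂
    obtain ⟨C₂, hC₂, h₂⟩ := IntervalLattice.exists_gInfNorm_le 𝕜 q r₂ r₁
    refine ⟨max C₁ C₂, lt_max_of_lt_left hC₁, fun L => ⟨Submodule.ext fun s => ?_, fun s => ?_⟩⟩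
    · exact ⟨fun h => (h₂ L s).trans_lt (ENNReal.mul_lt_top ENNReal.coe_lt_top h),
        fun h => (h₁ L s).trans_lt (ENNReal.mul_lt_top ENNReal.coe_lt_top h)⟩
    · refine ⟨(h₁ L s).trans ?_, (h₂ L s).trans ?_⟩
      · gcongr; exact le_max_left _ _
      · gcongr; exact le_max_right _ _
  · have hc : q.HolderConjugate q' := by
      rw [Real.holderConjugate_iff]
      exact ⟨hq, by simpa only [one_div] using hqq'⟩
    refine ⟨4, by norm_num, fun L => ⟨L.dualEquiv 𝕜 hc, fun g f => ⟨?_, ?_⟩, fun g => ⟨?_, ?_⟩⟩⟩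
    · exact (L.summable_pairingTerm hc f g).hasSum
    · exact (L.setIntegral_tsum_pairing hc f g).symm
    · exact L.norm_pairing_le hc g
    · have h := L.norm_le_norm_pairing hc g
      rw [IntervalLattice.dualEquiv_apply]
      linarith [norm_nonneg (L.pairing hc g)]

end
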